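/- Let $\mathfrak H_2$ be a complex Hilbert space, $\mathfrak H_1\neq\{0\}$ a closed subspace of it, and $\pi$ the orthogonal projection of $\mathfrak H_2$ onto $\mathfrak H_1$. For $j=1,2$ let $\mathfrak P_j\subset\mathfrak H_j$ be a self-dual cone, i.e. a closed convex set with $t\,\mathfrak P_j\subseteq\mathfrak P_j$ for all $t\ge 0$, $\mathfrak P_j\cap(-\mathfrak P_j)=\{0\}$ and $\mathfrak P_j=\{\eta\in\mathfrak H_j : \langle\eta,\xi\rangle\ge 0\ \text{for all}\ \xi\in\mathfrak P_j\}$. A vector $\eta\in\mathfrak P_j$ is strictly positive w.r.t. $\mathfrak P_j$ if $\langle\xi,\eta\rangle>0$ for all $\xi\in\mathfrak P_j\setminus\{0\}$; a bounded operator $A$ on $\mathfrak H_j$ preserves positivity w.r.t. $\mathfrak P_j$ if $A\mathfrak P_j\subseteq\mathfrak P_j$, and improves it if $A\xi$ is strictly positive for all $\xi\in\mathfrak P_j\setminus\{0\}$. For $j=1,2$ let $H_j\in\mathscr A^+_{\mathfrak P_j}$: $H_j$ is a (possibly unbounded) self-adjoint operator on $\mathfrak H_j$, bounded from below, whose spectrum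 is purely discrete (it consists of isolated eigenvalues of finite multiplicity), and, with $E(H_j)=\inf\mathrm{spec}(H_j)$, the operator $(H_j+s)^{-1}$ improves positivity w.r.t. $\mathfrak P_j$ for all $s>-E(H_j)$. Suppose that positivity is inherited from $\mathfrak P_1$ to $\mathfrak P_2$: $\mathfrak P_1=\pi\mathfrak P_2$, and $\pi$ preserves positivity w.r.t. $\mathfrak P_2$. For a unit vector $\psi$ let $\varrho_\psi=|\psi\rangle\langle\psi|$, and for a bounded operator $A$ on $\mathfrak H_2$ let $\mathscr E(A)=\pi A\pi+\pi^\perp A\pi^\perp$, where $\pi^\perp=1-\pi$. Then each $E(H_j)$ is a simple eigenvalue of $H_j$ with a strictly positive eigenvector, so that $H_j$ has a normalized ground state (a unit vector in $\ker(H_j-E(H_j))$), unique up to a phase. Let $\psi_{H_1},\psi_{H_2}$ be normalized ground states of $H_1,H_2$. If their phases are chosen such that $\psi_{H_j}\in\mathfrak P_j$ for $j=1,2$, then $$\langle\psi_{H_1},\pi\psi_{H_2}\rangle>0 .$$ Equivalently, whatever the phases, the operators $\varrho_{\psi_{H_1}}$ (on $\mathfrak H_2$) and $\mathscr E(\varrho_{\psi_{H_2}})$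 are Hilbert–Schmidt and $$\langle\varrho_{\psi_{H_1}},\mathscr E(\varrho_{\psi_{H_2}})\rangle_{HS}=\mathrm{tr}\big[\varrho_{\psi_{H_1}}^*\,\mathscr E(\varrho_{\psi_{H_2}})\big]>0 .$$ In addition, $\pi\,\mathscr E(\varrho_{\psi_{H_2}})\,\pi$, as an operator on $\mathfrak H_1$, improves positivity w.r.t. $\mathfrak P_1$. -/

import Mathlib

open scoped ComplexOrder

namespace StrictPositivity

section Cones

variable {H : Type*} [NormedAddCommGroup H] [InnerProductSpace ℂ H]

/-- The dual cone `{η | ⟨η, ξ⟩ ≥ 0 for all ξ ∈ P}`. The order is the one of `ℂ`: `0 ≤ z` means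
that `z` is real and nonnegative, and `0 < z` that `z` is real and positive. -/
def dualCone (P : Set H) : Set H :=
  {η | ∀ ξ ∈ P, 0 ≤ inner ℂ η ξ}

/-- A self-dual cone: a closed convex set, stable under multiplication by nonnegative reals, with
`P ∩ (-P) = {0}`, which coincides with its dual cone. -/
structure IsSelfDualCone (P : Set H) : Prop where
  isClosed : IsClosed P
  convex : ∀ x ∈ P, ∀ y ∈ P, ∀ s t : ℝ, 0 ≤ s → 0 ≤ t → s + t = 1 →
    (s : ℂ) • x + (t : ℂ) • y ∈ P
  smul_mem : ∀ t : ℝ, 0 ≤ t → ∀ x ∈ P, (t : ℂ) • x ∈ P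
  pointed : ∀ x : H, (x ∈ P ∧ -x ∈ P) ↔ x = 0
  selfDual : P = dualCone P

/-- `η > 0` with respect to `P`. -/
def StrictlyPositive (P : Set H) (η : H) : Prop :=
  η ∈ P ∧ ∀ ξ ∈ P, ξ ≠ 0 → 0 < inner ℂ ξ η

/-- The bounded operator `A` preserves the positivity with respect to `P`. -/
def PreservesPositivity (P : Set H) (A : H →L[ℂ] H) : Prop :=
  ∀ ξ ∈ P, A ξ ∈ P

/-- The bounded operator `A` improves the positivity with respect to `P`. -/
def ImprovesPositivity (P : Set H) (A : H →L[ℂ] H) : Prop :=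
  ∀ ξ ∈ P, ξ ≠ 0 → StrictlyPositive P (A ξ)

end Cones

section Unbounded

variable {H : Type*} [NormedAddCommGroup H] [InnerProductSpace ℂ H]

/-- The bounded operator `R` is the resolvent `(A - z)⁻¹` of the (unbounded) operator `A`: it maps
into the domain of `A` and is a two-sided inverse of `A - z : A.domain → H`. -/
structure IsResolvent (A : H →ₗ.[ℂ] H) (z : ℂ) (R : H →L[ℂ] H) : Prop where
  mem_domain : ∀ x : H, R x ∈ A.domain
  right_inv : ∀ x : H, A ⟨R x, mem_domain x⟩ - z • R x = x
  left_inv : ∀ x : A.domain, R (A x - z • (x : H)) = x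

/-- The spectrum of an unbounded operator. -/
def spec (A : H →ₗ.[ℂ] H) : Set ℂ :=
  {z | ¬ ∃ R : H →L[ℂ] H, IsResolvent A z R}

/-- `E(A) = inf spec(A)`. -/
noncomputable def bottom (A : H →ₗ.[ℂ] H) : ℝ :=
  sInf {r : ℝ | (r : ℂ) ∈ spec A}

/-- The eigenspace `ker (A - z)`, as a subspace of `H`. -/
def eigenspace (A : H →ₗ.[ℂ] H) (z : ℂ) : Submodule ℂ H :=
  (LinearMap.ker (A.toFun - z • A.domain.subtype)).map A.domain.subtype

/-- There is a real `c` with `⟨x, A x⟩ ≥ c ‖x‖²` on the domain of `A`. -/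
def IsBoundedBelow (A : H →ₗ.[ℂ] H) : Prop :=
  ∃ c : ℝ, ∀ x : A.domain, c * ‖(x : H)‖ ^ 2 ≤ (inner ℂ (x : H) (A x)).re

/-- The spectrum consists of isolated eigenvalues of finite multiplicity. -/
def HasPurelyDiscreteSpectrum (A : H →ₗ.[ℂ] H) : Prop :=
  ∀ z ∈ spec A, (∃ ε > 0, ∀ w ∈ spec A, dist w z < ε → w = z) ∧
    eigenspace A z ≠ ⊥ ∧ FiniteDimensional ℂ (eigenspace A z)

/-- The class of self-adjoint operators `A`, bounded from below and with purely discrete spectrum,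
such that `(A + s)⁻¹` improves the positivity with respect to `P` for all `s > -E(A)`. -/
structure MemAPlus [CompleteSpace H] (P : Set H) (A : H →ₗ.[ℂ] H) : Prop where
  isSelfAdjoint : IsSelfAdjoint A
  isBoundedBelow : IsBoundedBelow A
  discrete : HasPurelyDiscreteSpectrum A
  improves : ∀ s : ℝ, -bottom A < s →
    ∃ R : H →L[ℂ] H, IsResolvent A (-(s : ℂ)) R ∧ ImprovesPositivity P R

/-- `ψ` is a normalized ground state of `A`: a unit vector in `ker (A - E(A))`. -/
def IsGroundState (A : H →ₗ.[ℂ] H) (ψ : H) : Prop :=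
  ‖ψ‖ = 1 ∧ ψ ∈ eigenspace A (bottom A : ℂ)

end Unbounded

section Inheritance

variable {H : Type*} [NormedAddCommGroup H] [InnerProductSpace ℂ H]
variable (K : Submodule ℂ H) [K.HasOrthogonalProjection]

/-- Positivity is inherited from the cone `P₁` in the closed subspace `K` to the cone `P₂` in `H`:
`P₁ = π P₂`, and `π` preserves the positivity with respect to `P₂`, where `π` is the orthogonal
projection onto `K` (regarded as a map to `K` in the first, to `H` in the second condition). -/
structure PositivityInherited (P₁ : Set K) (P₂ : Set H) : Prop where
  eq_image : P₁ = K.orthogonalProjectionOnto '' P₂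
  preserves : PreservesPositivity P₂ K.starProjection

/-- The strict `P₂`-positivity of `A₂` is inherited from the strict `P₁`-positivity of `A₁`. -/
structure StrictPositivityInherited [CompleteSpace H] [CompleteSpace K]
    (A₁ : K →ₗ.[ℂ] K) (P₁ : Set K) (A₂ : H →ₗ.[ℂ] H) (P₂ : Set H) : Prop where
  mem₁ : MemAPlus P₁ A₁
  mem₂ : MemAPlus P₂ A₂
  inherited : PositivityInherited K P₁ P₂

/-- The conditional expectation `E(A) = π A π + π^⊥ A π^⊥`. -/
noncomputable def condExpectation (A : H →L[ℂ] H) : H →L[ℂ] H :=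
  K.starProjection ∘L A ∘L K.starProjection + Kᗮ.starProjection ∘L A ∘L Kᗮ.starProjection

/-- The compression `π A π` to the closed subspace `K`, as an operator on `K`. -/
noncomputable def compression (A : H →L[ℂ] H) : K →L[ℂ] K :=
  K.orthogonalProjectionOnto ∘L A ∘L K.subtypeL

end Inheritance

section HilbertSchmidt

variable {H : Type*} [NormedAddCommGroup H] [InnerProductSpace ℂ H] {ι : Type*}

/-- The operator `|ψ⟩⟨ψ|`. -/
noncomputable def rho (ψ : H) : H →L[ℂ] H :=
  InnerProductSpace.rankOne ℂ ψ ψ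

/-- `A` is Hilbert-Schmidt: `∑ ‖A bᵢ‖² < ∞`, tested in the orthonormal basis `b`. -/
def IsHilbertSchmidt (b : HilbertBasis ι ℂ H) (A : H →L[ℂ] H) : Prop :=
  Summable fun i => ‖A (b i)‖ ^ 2

/-- The Hilbert-Schmidt inner product `tr (A* B) = ∑ ⟨bᵢ, A* B bᵢ⟩`, computed in the orthonormal
basis `b`. -/
noncomputable def hsInner [CompleteSpace H] (b : HilbertBasis ι ℂ H) (A B : H →L[ℂ] H) : ℂ :=
  ∑' i, inner ℂ (b i) ((ContinuousLinearMap.adjoint A ∘L B) (b i))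

end HilbertSchmidt

end StrictPositivity

/-! Both ground states are Perron–Frobenius vectors. Below the spectrum, the resolvent `R` is
self-adjoint and improves positivity, and its norm `(E + s)⁻¹` is an eigenvalue whose eigenspace is
that of the ground state energy. If a real eigenvector `p - q` had orthogonal nonzero parts `p`, `q`
in the cone, `p + q` would have the same norm but a strictly larger quadratic form, exceeding `‖R‖`.
So real eigenvectors are strictly positive up to sign, and two such vectors cannot be orthogonal;
this gives simplicity.

Inheritance enters only through two facts: `P₁`, seen in `H`, lies in `P₂`, and hence `π` sends
strictly positive vectors to strictly positive ones. The overlap of `ψ₁` with `π ψ₂` is then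
positive. On `K`, the operator `𝓔(ϱ_ψ₂)` is `ξ ↦ ⟨ψ₂, ξ⟩ π ψ₂`, which yields the other two claims.
-/

namespace StrictPositivity

/-! ### Self-dual cones and the real subspace they span -/

section Cones

variable {H : Type*} [NormedAddCommGroup H] [InnerProductSpace ℂ H]

/-- The projection of a vector to a closed convex cone of a complex Hilbert space. -/
theorem exists_cone_projection [CompleteSpace H] {C : Set H} (hC : IsClosed C) (h0 : (0 : H) ∈ C)
    (hadd : ∀ x ∈ C, ∀ y ∈ C, x + y ∈ C) (hsmul : ∀ t : ℝ, 0 ≤ t → ∀ x ∈ C, (t : ℂ) • x ∈ C)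
    (x : H) :
    ∃ p ∈ C, (∀ w ∈ C, (inner ℂ (x - p) w).re ≤ 0) ∧ (inner ℂ (x - p) p).re = 0 := by
  let : InnerProductSpace ℝ H := InnerProductSpace.rclikeToReal ℂ H
  have hconv : Convex ℝ C := by
    intro u hu v hv s t hs ht _
    exact hadd _ (hsmul s hs u hu) _ (hsmul t ht v hv)
  obtain ⟨p, hp, hmin⟩ := exists_norm_eq_iInf_of_complete_convex ⟨0, h0⟩ hC.isComplete hconv x
  have key : ∀ w ∈ C, (inner ℂ (x - p) (w - p)).re ≤ 0 :=
    (norm_eq_iInf_iff_real_inner_le_zero hconv hp).1 hmin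
  have hzero : (inner ℂ (x - p) p).re = 0 := by
    -- Testing with `0` and `2p` gives both signs.
    have h1 := key _ h0
    have h2 := key _ (hadd p hp p hp)
    rw [zero_sub, inner_neg_right, Complex.neg_re] at h1
    rw [add_sub_cancel_right] at h2
    linarith
  refine ⟨p, hp, fun w hw => ?_, hzero⟩
  have := key w hw
  rwa [inner_sub_right, Complex.sub_re, hzero, sub_zero] at this

/-- The vectors which have real inner products with all elements of `P`. -/
def realPart (P : Set H) : Set H :=
  {x | ∀ ξ ∈ P, (inner ℂ x ξ).im = 0}

theorem isClosed_realPart (P : Set H) : IsClosed (realPart P) := by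
  have : realPart P = ⋂ ξ ∈ P, {x : H | (inner ℂ x ξ).im = 0} := by
    ext x
    simp [realPart]
  rw [this]
  exact isClosed_biInter fun ξ _ =>
    isClosed_eq (Complex.continuous_im.comp (continuous_id.inner continuous_const))
      continuous_const

theorem add_mem_realPart {P : Set H} {x y : H} (hx : x ∈ realPart P) (hy : y ∈ realPart P) :
    x + y ∈ realPart P := fun ξ hξ => by
  rw [inner_add_left, Complex.add_im, hx ξ hξ, hy ξ hξ, add_zero]

theorem smul_mem_realPart {P : Set H} (t : ℝ) {x : H} (hx : x ∈ realPart P) :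
    (t : ℂ) • x ∈ realPart P := fun ξ hξ => by
  rw [inner_smul_left, Complex.conj_ofReal, Complex.im_ofReal_mul, hx ξ hξ, mul_zero]

theorem neg_mem_realPart {P : Set H} {x : H} (hx : x ∈ realPart P) : -x ∈ realPart P :=
  fun ξ hξ => by rw [inner_neg_left, Complex.neg_im, hx ξ hξ, neg_zero]

theorem sub_mem_realPart {P : Set H} {x y : H} (hx : x ∈ realPart P) (hy : y ∈ realPart P) :
    x - y ∈ realPart P :=
  sub_eq_add_neg x y ▸ add_mem_realPart hx (neg_mem_realPart hy)

namespace IsSelfDualCone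

variable {P : Set H}

theorem inner_nonneg (hP : IsSelfDualCone P) {x y : H} (hx : x ∈ P) (hy : y ∈ P) :
    0 ≤ inner ℂ x y :=
  (hP.selfDual ▸ hx : x ∈ dualCone P) y hy

theorem mem_of_inner_nonneg (hP : IsSelfDualCone P) {x : H} (hx : ∀ ξ ∈ P, 0 ≤ inner ℂ x ξ) :
    x ∈ P := by
  rw [hP.selfDual]
  exact hx

theorem zero_mem (hP : IsSelfDualCone P) : (0 : H) ∈ P :=
  hP.mem_of_inner_nonneg fun ξ _ => by rw [inner_zero_left]

theorem add_mem (hP : IsSelfDualCone P) {x y : H} (hx : x ∈ P) (hy : y ∈ P) : x + y ∈ P :=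
  hP.mem_of_inner_nonneg fun ξ hξ => by
    rw [inner_add_left]
    exact add_nonneg (hP.inner_nonneg hx hξ) (hP.inner_nonneg hy hξ)

theorem subset_realPart (hP : IsSelfDualCone P) {x : H} (hx : x ∈ P) : x ∈ realPart P :=
  fun _ hξ => (Complex.nonneg_iff.1 (hP.inner_nonneg hx hξ)).2.symm

variable [CompleteSpace H]

/-- A real vector is the difference of two orthogonal elements of the cone. -/
theorem exists_jordan_decomposition (hP : IsSelfDualCone P) {x : H} (hx : x ∈ realPart P) :
    ∃ p ∈ P, ∃ q ∈ P, x = p - q ∧ inner ℂ p q = 0 := by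
  obtain ⟨p, hp, hle, hzero⟩ := exists_cone_projection hP.isClosed hP.zero_mem
    (fun _ hu _ hv => hP.add_mem hu hv) hP.smul_mem x
  have hq : p - x ∈ P := hP.mem_of_inner_nonneg fun ξ hξ => by
    rw [Complex.nonneg_iff]
    refine ⟨?_, (sub_mem_realPart (hP.subset_realPart hp) hx ξ hξ).symm⟩
    have := hle ξ hξ
    rw [← neg_sub, inner_neg_left, Complex.neg_re] at this
    linarith
  refine ⟨p, hp, p - x, hq, by abel, ?_⟩
  have him := (Complex.nonneg_iff.1 (hP.inner_nonneg hp hq)).2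
  refine Complex.ext ?_ him.symm
  rw [← inner_conj_symm, Complex.conj_re, ← neg_sub, inner_neg_left, Complex.neg_re, hzero,
    neg_zero, Complex.zero_re]

/-- The inner product of two real vectors is real. -/
theorem inner_im_eq_zero (hP : IsSelfDualCone P) {x y : H} (hx : x ∈ realPart P)
    (hy : y ∈ realPart P) : (inner ℂ x y).im = 0 := by
  obtain ⟨p, hp, q, hq, rfl, -⟩ := hP.exists_jordan_decomposition hy
  rw [inner_sub_right, Complex.sub_im, hx p hp, hx q hq, sub_zero]

/-- Every vector is of the form `a + i b` with `a` and `b` real. -/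
theorem exists_real_add_I_smul (hP : IsSelfDualCone P) (x : H) :
    ∃ a ∈ realPart P, ∃ b ∈ realPart P, x = a + Complex.I • b := by
  obtain ⟨a, ha, hle, -⟩ := exists_cone_projection (isClosed_realPart P)
    (hP.subset_realPart hP.zero_mem) (fun _ hu _ hv => add_mem_realPart hu hv)
    (fun t _ _ hu => smul_mem_realPart t hu) x
  refine ⟨a, ha, -Complex.I • (x - a), fun ξ hξ => ?_, ?_⟩
  · have h1 := hle ξ (hP.subset_realPart hξ)
    have h2 := hle (-ξ) (neg_mem_realPart (hP.subset_realPart hξ))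
    rw [inner_neg_right, Complex.neg_re] at h2
    rw [inner_smul_left]
    simp only [map_neg, Complex.conj_I, neg_neg, Complex.mul_im, Complex.I_re, Complex.I_im]
    linarith
  · rw [smul_smul]
    simp

/-- A real vector which is `i` times a real vector vanishes. -/
theorem eq_zero_of_add_I_smul_eq_zero (hP : IsSelfDualCone P) {a b : H} (ha : a ∈ realPart P)
    (hb : b ∈ realPart P) (h : a + Complex.I • b = 0) : a = 0 ∧ b = 0 := by
  have hb0 : b = 0 := by
    -- With `a = -i b`, the number `⟨b, a⟩ = -i ‖b‖²` is real only if `b = 0`.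
    have him := hP.inner_im_eq_zero hb ha
    rw [eq_neg_of_add_eq_zero_left h, inner_neg_right, inner_smul_right,
      inner_self_eq_norm_sq_to_K] at him
    have : ‖b‖ ^ 2 = 0 := by
      simpa [← Complex.ofReal_pow] using him
    simpa using this
  refine ⟨?_, hb0⟩
  simpa [hb0] using h

end IsSelfDualCone

theorem StrictlyPositive.smul {P : Set H} (hP : IsSelfDualCone P) {η : H}
    (hη : StrictlyPositive P η) {t : ℝ} (ht : 0 < t) : StrictlyPositive P ((t : ℂ) • η) := by
  refine ⟨hP.smul_mem t ht.le η hη.1, fun ξ hξ h0 => ?_⟩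
  rw [inner_smul_right]
  exact mul_pos (Complex.zero_lt_real.2 ht) (hη.2 ξ hξ h0)

/-! ### Perron–Frobenius theory for bounded operators -/

section PerronFrobenius

variable {P : Set H} {R : H →L[ℂ] H}

theorem map_mem_realPart [CompleteSpace H] (hR : IsSelfAdjoint R) (hRP : ImprovesPositivity P R)
    {x : H} (hx : x ∈ realPart P) : R x ∈ realPart P := fun ξ hξ => by
  rw [show inner ℂ (R x) ξ = inner ℂ x (R ξ) from hR.isSymmetric x ξ]
  by_cases h0 : ξ = 0
  · simp [h0]
  · exact hx _ (hRP ξ hξ h0).1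

/-- `x` is a positive multiple of `R x`, which is strictly positive. -/
theorem strictlyPositive_of_eigenvector (hP : IsSelfDualCone P) (hRP : ImprovesPositivity P R)
    {x : H} (hx : x ∈ P) (h0 : x ≠ 0) (hμ : 0 < ‖R‖) (hRx : R x = (‖R‖ : ℂ) • x) :
    StrictlyPositive P x := by
  have : x = ((‖R‖⁻¹ : ℝ) : ℂ) • R x := by
    rw [hRx, smul_smul, ← Complex.ofReal_mul, inv_mul_cancel₀ hμ.ne', Complex.ofReal_one, one_smul]
  rw [this]
  exact (hRP x hx h0).smul hP (inv_pos.2 hμ)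

/-- A real eigenvector for the eigenvalue `‖R‖` is strictly positive up to a sign. -/
theorem strictlyPositive_or_neg_of_eigenvector [CompleteSpace H] (hP : IsSelfDualCone P)
    (hRP : ImprovesPositivity P R) {x : H} (hx : x ∈ realPart P) (h0 : x ≠ 0)
    (hμ : 0 < ‖R‖) (hRx : R x = (‖R‖ : ℂ) • x) :
    StrictlyPositive P x ∨ StrictlyPositive P (-x) := by
  obtain ⟨p, hp, q, hq, rfl, hpq⟩ := hP.exists_jordan_decomposition hx
  have hqp : inner ℂ q p = 0 := by rw [← inner_conj_symm, hpq, map_zero]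
  by_cases hp0 : p = 0
  · right
    subst hp0
    refine strictlyPositive_of_eigenvector hP hRP (by simpa using hq) (neg_ne_zero.2 h0) hμ ?_
    rw [map_neg, hRx, smul_neg]
  by_cases hq0 : q = 0
  · left
    subst hq0
    exact strictlyPositive_of_eigenvector hP hRP (by simpa using hp) h0 hμ hRx
  exfalso
  -- The cross terms are positive, so passing from `p - q` to `p + q` keeps the norm and strictly
  -- raises the quadratic form above its bound.
  have hpos : 0 < (inner ℂ q (R p)).re := (Complex.pos_iff.1 ((hRP p hp hp0).2 q hq hq0)).1
  have hpos' : 0 < (inner ℂ p (R q)).re := (Complex.pos_iff.1 ((hRP q hq hq0).2 p hp hp0)).1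
  have hnorm : ‖p + q‖ = ‖p - q‖ := by
    refine (sq_eq_sq₀ (norm_nonneg _) (norm_nonneg _)).1 ?_
    rw [@norm_add_sq ℂ, @norm_sub_sq ℂ, hpq]
    simp
  have hle : (inner ℂ (p + q) (R (p + q))).re ≤ ‖R‖ * ‖p + q‖ ^ 2 := by
    calc (inner ℂ (p + q) (R (p + q))).re ≤ ‖inner ℂ (p + q) (R (p + q))‖ := Complex.re_le_norm _
      _ ≤ ‖p + q‖ * ‖R (p + q)‖ := norm_inner_le_norm _ _
      _ ≤ ‖p + q‖ * (‖R‖ * ‖p + q‖) := by gcongr; exact R.le_opNorm _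
      _ = _ := by ring
  have heq : (inner ℂ (p - q) (R (p - q))).re = ‖R‖ * ‖p - q‖ ^ 2 := by
    rw [hRx, inner_smul_right, Complex.re_ofReal_mul]
    congr 1
    exact inner_self_eq_norm_sq (𝕜 := ℂ) (p - q)
  rw [hnorm, ← heq] at hle
  simp only [map_add, map_sub, inner_add_left, inner_add_right, inner_sub_left, inner_sub_right,
    Complex.add_re, Complex.sub_re] at hle
  linarith

/-- **Perron-Frobenius**: if `‖R‖` is an eigenvalue of `R`, then it is simple, with a strictly
positive eigenvector. -/
theorem exists_strictlyPositive_eigenvector [CompleteSpace H] (hP : IsSelfDualCone P)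
    (hR : IsSelfAdjoint R) (hRP : ImprovesPositivity P R) (hμ : 0 < ‖R‖)
    (hex : ∃ x : H, x ≠ 0 ∧ R x = (‖R‖ : ℂ) • x) :
    ∃ ψ : H, ‖ψ‖ = 1 ∧ R ψ = (‖R‖ : ℂ) • ψ ∧ StrictlyPositive P ψ ∧
      ∀ φ : H, R φ = (‖R‖ : ℂ) • φ → ∃ c : ℂ, φ = c • ψ := by
  have hsplit : ∀ x : H, R x = (‖R‖ : ℂ) • x → ∃ a ∈ realPart P, ∃ b ∈ realPart P,
      x = a + Complex.I • b ∧ R a = (‖R‖ : ℂ) • a ∧ R b = (‖R‖ : ℂ) • b := by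
    intro x hx
    obtain ⟨a, ha, b, hb, rfl⟩ := hP.exists_real_add_I_smul x
    have := hP.eq_zero_of_add_I_smul_eq_zero
      (sub_mem_realPart (map_mem_realPart hR hRP ha) (smul_mem_realPart ‖R‖ ha))
      (sub_mem_realPart (map_mem_realPart hR hRP hb) (smul_mem_realPart ‖R‖ hb)) (by
        rw [map_add, map_smul, smul_add, smul_comm] at hx
        rw [smul_sub, sub_add_sub_comm, sub_eq_zero]
        exact hx)
    exact ⟨a, ha, b, hb, rfl, sub_eq_zero.1 this.1, sub_eq_zero.1 this.2⟩
  have hreal : ∃ a ∈ realPart P, a ≠ 0 ∧ R a = (‖R‖ : ℂ) • a := by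
    obtain ⟨x, hx0, hx⟩ := hex
    obtain ⟨a, ha, b, hb, rfl, hRa, hRb⟩ := hsplit x hx
    by_cases ha0 : a = 0
    · exact ⟨b, hb, fun hb0 => hx0 (by simp [ha0, hb0]), hRb⟩
    · exact ⟨a, ha, ha0, hRa⟩
  have hposex : ∃ p : H, p ≠ 0 ∧ StrictlyPositive P p ∧ R p = (‖R‖ : ℂ) • p := by
    obtain ⟨a, ha, ha0, hRa⟩ := hreal
    rcases strictlyPositive_or_neg_of_eigenvector hP hRP ha ha0 hμ hRa with h | h
    · exact ⟨a, ha0, h, hRa⟩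
    · exact ⟨-a, neg_ne_zero.2 ha0, h, by rw [map_neg, hRa, smul_neg]⟩
  obtain ⟨p, hp0, hp, hRp⟩ := hposex
  have hpn : 0 < ‖p‖ := norm_pos_iff.2 hp0
  have hψ := hp.smul hP (inv_pos.2 hpn)
  set ψ : H := ((‖p‖⁻¹ : ℝ) : ℂ) • p with hψdef
  have hnorm : ‖ψ‖ = 1 := by
    rw [hψdef, norm_smul, Complex.norm_real, Real.norm_of_nonneg (inv_nonneg.2 hpn.le),
      inv_mul_cancel₀ hpn.ne']
  have hψ0 : ψ ≠ 0 := norm_ne_zero_iff.1 (by rw [hnorm]; exact one_ne_zero)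
  have hRψ : R ψ = (‖R‖ : ℂ) • ψ := by rw [hψdef, map_smul, hRp, smul_comm]
  -- The component of `a` orthogonal to `ψ` is a real eigenvector; if nonzero, it would be strictly
  -- positive up to sign and so not orthogonal to `ψ`.
  have huniq : ∀ a ∈ realPart P, R a = (‖R‖ : ℂ) • a → a = (inner ℂ ψ a : ℂ) • ψ := by
    intro a ha hRa
    have hψr := hP.subset_realPart hψ.1
    have hc : ((inner ℂ ψ a : ℂ).re : ℂ) = inner ℂ ψ a :=
      Complex.ext rfl (by rw [Complex.ofReal_im, hP.inner_im_eq_zero hψr ha])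
    have hd : a - (inner ℂ ψ a : ℂ) • ψ ∈ realPart P :=
      sub_mem_realPart ha (hc ▸ smul_mem_realPart _ hψr)
    have hRd : R (a - (inner ℂ ψ a : ℂ) • ψ) = (‖R‖ : ℂ) • (a - (inner ℂ ψ a : ℂ) • ψ) := by
      rw [map_sub, map_smul, hRa, hRψ, smul_sub, smul_comm]
    have horth : inner ℂ ψ (a - (inner ℂ ψ a : ℂ) • ψ) = 0 := by
      rw [inner_sub_right, inner_smul_right, inner_self_eq_norm_sq_to_K, hnorm]
      simp
    by_contra hne
    rcases strictlyPositive_or_neg_of_eigenvector hP hRP hd (sub_ne_zero.2 hne) hμ hRd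
      with h | h
    · exact (h.2 ψ hψ.1 hψ0).ne' horth
    · refine (h.2 ψ hψ.1 hψ0).ne' ?_
      rw [inner_neg_right, horth, neg_zero]
  refine ⟨ψ, hnorm, hRψ, hψ, fun φ hφ => ?_⟩
  obtain ⟨a, ha, b, hb, rfl, hRa, hRb⟩ := hsplit φ hφ
  refine ⟨inner ℂ ψ a + Complex.I * inner ℂ ψ b, ?_⟩
  rw [add_smul, mul_smul, ← huniq a ha hRa, ← huniq b hb hRb]

end PerronFrobenius

end Cones

/-! ### Resolvents and ground states of unbounded operators -/

section Unbounded

variable {H : Type*} [NormedAddCommGroup H] [InnerProductSpace ℂ H] {A : H →ₗ.[ℂ] H}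

theorem mem_eigenspace_iff {z : ℂ} {x : H} :
    x ∈ eigenspace A z ↔ ∃ hx : x ∈ A.domain, A ⟨x, hx⟩ = z • x := by
  simp only [eigenspace, Submodule.mem_map, LinearMap.mem_ker, LinearMap.sub_apply,
    LinearMap.smul_apply, Submodule.subtype_apply, sub_eq_zero]
  constructor
  · rintro ⟨y, hy, rfl⟩
    exact ⟨y.2, hy⟩
  · rintro ⟨hx, h⟩
    exact ⟨⟨x, hx⟩, h, rfl⟩

/-- Spectral points are eigenvalues, so the form bound is a lower bound for them and `sInf` is not a
default value. -/
theorem bottom_le (hb : IsBoundedBelow A) (hd : HasPurelyDiscreteSpectrum A) {r : ℝ}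
    (hr : (r : ℂ) ∈ spec A) : bottom A ≤ r := by
  obtain ⟨c, hc⟩ := hb
  refine csInf_le ⟨c, fun t ht => ?_⟩ hr
  obtain ⟨x, hx, hx0⟩ := Submodule.exists_mem_ne_zero_of_ne_bot (hd _ ht).2.1
  obtain ⟨hxd, hAx⟩ := mem_eigenspace_iff.1 hx
  have h := hc ⟨x, hxd⟩
  have hxn : 0 < ‖x‖ := norm_pos_iff.2 hx0
  rw [hAx, inner_smul_right, Complex.re_ofReal_mul] at h
  rw [show (inner ℂ x x).re = ‖x‖ ^ 2 from inner_self_eq_norm_sq (𝕜 := ℂ) x] at h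
  exact le_of_mul_le_mul_right h (by positivity)

namespace IsResolvent

variable {z w : ℂ} {R T : H →L[ℂ] H}

theorem mem_eigenspace_iff (hR : IsResolvent A z R) (hwz : w ≠ z) {x : H} :
    x ∈ eigenspace A w ↔ R x = (w - z)⁻¹ • x := by
  have hne : w - z ≠ 0 := sub_ne_zero.2 hwz
  rw [StrictPositivity.mem_eigenspace_iff]
  constructor
  · rintro ⟨hx, h⟩
    have := hR.left_inv ⟨x, hx⟩
    rw [h, ← sub_smul, map_smul] at this
    rw [eq_inv_smul_iff₀ hne, this]
  · intro h
    have hx' : x = (w - z) • R x := by rw [h, smul_inv_smul₀ hne]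
    have hx : x ∈ A.domain := hx' ▸ A.domain.smul_mem _ (hR.mem_domain x)
    refine ⟨hx, ?_⟩
    have hmk : (⟨x, hx⟩ : A.domain) = (w - z) • ⟨R x, hR.mem_domain x⟩ := Subtype.ext hx'
    rw [hmk, LinearPMap.map_smul, eq_add_of_sub_eq (hR.right_inv x), smul_add, smul_comm, ← hx',
      ← add_smul, sub_add_cancel]

/-- The resolvent identity. -/
theorem sub_apply (hR : IsResolvent A z R) (hT : IsResolvent A w T) (x : H) :
    T x - R x = (w - z) • R (T x) := by
  have h := hR.left_inv ⟨T x, hT.mem_domain x⟩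
  rw [eq_add_of_sub_eq (hT.right_inv x), add_sub_assoc, ← sub_smul, map_add, map_smul] at h
  exact sub_eq_iff_eq_add'.2 h.symm

theorem commute (hR : IsResolvent A z R) (hT : IsResolvent A w T) (hwz : w ≠ z) (x : H) :
    R (T x) = T (R x) := by
  have h1 := hR.sub_apply hT x
  have h2 := hT.sub_apply hR x
  refine smul_right_injective H (sub_ne_zero.2 hwz) ?_
  change (w - z) • _ = (w - z) • _
  rw [← h1, ← neg_sub, h2, ← neg_smul, neg_sub]

/-- If `T` were the resolvent at `z + μ⁻¹`, the resolvent identity would make `μ⁻¹ (1 + μ⁻¹ T)` an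
inverse of `μ - R`. -/
theorem mem_spec_of_mem_spectrum (hR : IsResolvent A z R) {μ : ℂ} (hμ : μ ≠ 0)
    (h : μ ∈ spectrum ℂ R) : z + μ⁻¹ ∈ spec A := by
  rintro ⟨T, hT⟩
  refine h ?_
  have hwz : z + μ⁻¹ ≠ z := by simp [hμ]
  have hsub : ∀ x, T x - R x = μ⁻¹ • R (T x) := fun x => by
    simpa using hR.sub_apply hT x
  have hinv : ∀ x, μ • (μ⁻¹ • (x + μ⁻¹ • T x)) - R (μ⁻¹ • (x + μ⁻¹ • T x)) = x := fun x => by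
    rw [smul_inv_smul₀ hμ, map_smul, map_add, map_smul, ← hsub x]
    simp
  have hcomm : ∀ x, (μ⁻¹ • (μ • x - R x + μ⁻¹ • T (μ • x - R x))) =
      μ • (μ⁻¹ • (x + μ⁻¹ • T x)) - R (μ⁻¹ • (x + μ⁻¹ • T x)) := fun x => by
    have := hR.commute hT hwz x
    simp only [map_sub, map_add, map_smul, this, smul_sub, smul_add, smul_smul]
    module
  let B : H →L[ℂ] H := μ⁻¹ • (1 + μ⁻¹ • T)
  refine isUnit_iff_exists.2 ⟨B, ?_, ?_⟩
  · ext x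
    simpa [B, Algebra.algebraMap_eq_smul_one] using hinv x
  · ext x
    simpa [B, Algebra.algebraMap_eq_smul_one] using (hcomm x).trans (hinv x)

theorem injective (hR : IsResolvent A z R) {x : H} (h : R x = 0) : x = 0 := by
  have := hR.right_inv x
  have h0 : (⟨R x, hR.mem_domain x⟩ : A.domain) = 0 := Subtype.ext h
  rwa [h0, LinearPMap.map_zero, h, smul_zero, sub_zero, eq_comm] at this

theorem isSelfAdjoint [CompleteSpace H] {s : ℝ} (hA : IsSelfAdjoint A)
    (hR : IsResolvent A (s : ℂ) R) : IsSelfAdjoint R := by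
  rw [ContinuousLinearMap.isSelfAdjoint_iff_isSymmetric]
  have hsymm : A.IsFormalAdjoint A := by
    have := LinearPMap.adjoint_isFormalAdjoint hA.dense_domain
    rwa [LinearPMap.isSelfAdjoint_def.1 hA] at this
  intro x y
  change inner ℂ (R x) y = inner ℂ x (R y)
  have h := hsymm ⟨R x, hR.mem_domain x⟩ ⟨R y, hR.mem_domain y⟩
  rw [eq_add_of_sub_eq (hR.right_inv x), eq_add_of_sub_eq (hR.right_inv y), inner_add_left,
    inner_add_right, inner_smul_left, inner_smul_right, Complex.conj_ofReal] at h
  exact (add_right_cancel h).symm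

end IsResolvent

variable [CompleteSpace H] [Nontrivial H]

/-- The norm of the resolvent at a point below the spectrum, and the ground state energy as an
element of the spectrum. -/
theorem norm_resolvent_eq (hA : IsSelfAdjoint A) (hb : IsBoundedBelow A)
    (hd : HasPurelyDiscreteSpectrum A) {s : ℝ} (hs : -bottom A < s) {R : H →L[ℂ] H}
    (hR : IsResolvent A (-(s : ℂ)) R) :
    ‖R‖ = (bottom A + s)⁻¹ ∧ (bottom A : ℂ) ∈ spec A := by
  have hcast : (-(s : ℂ)) = ((-s : ℝ) : ℂ) := by push_cast; rfl
  have hRsa : IsSelfAdjoint R := (hcast ▸ hR).isSelfAdjoint hA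
  have hRne : R ≠ 0 := by
    rintro rfl
    obtain ⟨x, hx⟩ := exists_ne (0 : H)
    exact hx (hR.injective rfl)
  have hRn : 0 < ‖R‖ := norm_pos_iff.2 hRne
  have hspec : ∀ t : ℝ, t ≠ 0 → t ∈ spectrum ℝ R → ((-s + t⁻¹ : ℝ) : ℂ) ∈ spec A := by
    intro t ht h
    have := hR.mem_spec_of_mem_spectrum (Complex.ofReal_ne_zero.2 ht)
      (spectrum.algebraMap_mem ℂ h)
    simpa using this
  have hmem : ((-s + ‖R‖⁻¹ : ℝ) : ℂ) ∈ spec A := by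
    -- The value `-‖R‖` would put a point of the spectrum of `A` below `-s`, hence below `bottom A`.
    rcases CStarAlgebra.norm_or_neg_norm_mem_spectrum hRsa with h | h
    · exact hspec _ hRn.ne' h
    · have h1 := bottom_le hb hd (hspec _ (neg_ne_zero.2 hRn.ne') h)
      rw [inv_neg] at h1
      have := inv_pos.2 hRn
      linarith
  have hbot : bottom A = -s + ‖R‖⁻¹ := by
    -- Conversely, each real spectral point `r` gives `R` the eigenvalue `(r + s)⁻¹`, at most `‖R‖`.
    refine le_antisymm (bottom_le hb hd hmem) (le_csInf ⟨_, hmem⟩ fun r hr => ?_)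
    have hrs : 0 < r + s := by linarith [bottom_le hb hd hr]
    obtain ⟨x, hx, hx0⟩ := Submodule.exists_mem_ne_zero_of_ne_bot (hd _ hr).2.1
    have hne : (r : ℂ) ≠ -(s : ℂ) := by
      rw [hcast]
      exact fun h => by linarith [Complex.ofReal_injective h]
    rw [hR.mem_eigenspace_iff hne] at hx
    have h1 := R.le_opNorm x
    rw [hx, sub_neg_eq_add, ← Complex.ofReal_add, ← Complex.ofReal_inv, norm_smul,
      Complex.norm_real, Real.norm_of_nonneg (inv_nonneg.2 hrs.le)] at h1
    have h2 := inv_anti₀ (inv_pos.2 hrs) (le_of_mul_le_mul_right h1 (norm_pos_iff.2 hx0))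
    rw [inv_inv] at h2
    linarith
  refine ⟨?_, hbot ▸ hmem⟩
  rw [hbot]
  simp

/-- The ground state energy is a simple eigenvalue with a strictly positive eigenvector, and all
ground states in the cone are strictly positive. -/
theorem MemAPlus.exists_groundState {P : Set H} (hP : IsSelfDualCone P) (h : MemAPlus P A) :
    ∃ ψ : H, IsGroundState A ψ ∧ StrictlyPositive P ψ ∧
      (∀ φ : H, IsGroundState A φ → ∃ c : ℂ, ‖c‖ = 1 ∧ φ = c • ψ) ∧
      ∀ φ : H, IsGroundState A φ → φ ∈ P → StrictlyPositive P φ := by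
  -- This shift normalizes `‖R‖` to `1`.
  have hs : -bottom A < -bottom A + 1 := by linarith
  obtain ⟨R, hR, hRP⟩ := h.improves _ hs
  obtain ⟨hnorm, hmem⟩ := norm_resolvent_eq h.isSelfAdjoint h.isBoundedBelow h.discrete hs hR
  have hn1 : ‖R‖ = 1 := by rw [hnorm]; simp
  have hRsa : IsSelfAdjoint R := by
    refine IsResolvent.isSelfAdjoint (s := -(-bottom A + 1)) h.isSelfAdjoint ?_
    rwa [Complex.ofReal_neg]
  have heig : ∀ x, x ∈ eigenspace A (bottom A : ℂ) ↔ R x = (‖R‖ : ℂ) • x := by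
    intro x
    rw [hR.mem_eigenspace_iff, hn1]
    · simp
    · intro h
      simpa using congrArg Complex.re h
  obtain ⟨x, hx, hx0⟩ := Submodule.exists_mem_ne_zero_of_ne_bot (h.discrete _ hmem).2.1
  have hpos : 0 < ‖R‖ := hn1 ▸ one_pos
  obtain ⟨ψ, hψ1, hRψ, hψ, huniq⟩ := exists_strictlyPositive_eigenvector hP hRsa hRP hpos
    ⟨x, hx0, (heig x).1 hx⟩
  refine ⟨ψ, ⟨hψ1, (heig ψ).2 hRψ⟩, hψ, fun φ hφ => ?_, fun φ hφ hφP => ?_⟩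
  · obtain ⟨c, rfl⟩ := huniq φ ((heig φ).1 hφ.2)
    refine ⟨c, ?_, rfl⟩
    have := hφ.1
    rwa [norm_smul, hψ1, mul_one] at this
  · exact strictlyPositive_of_eigenvector hP hRP hφP
      (norm_ne_zero_iff.1 (by rw [hφ.1]; exact one_ne_zero)) hpos ((heig φ).1 hφ.2)

end Unbounded

/-! ### Inherited positivity and the conditional expectation -/

section Inheritance

variable {H : Type*} [NormedAddCommGroup H] [InnerProductSpace ℂ H] {K : Submodule ℂ H}
  [K.HasOrthogonalProjection] {P₁ : Set K} {P₂ : Set H}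

/-- An element of `P₁` is `π q` with `q ∈ P₂`, and `π` maps `P₂` into itself. -/
theorem PositivityInherited.coe_mem (h : PositivityInherited K P₁ P₂) {ξ : K} (hξ : ξ ∈ P₁) :
    (ξ : H) ∈ P₂ := by
  obtain ⟨q, hq, rfl⟩ := (h.eq_image ▸ hξ : ξ ∈ K.orthogonalProjectionOnto '' P₂)
  exact h.preserves q hq

theorem PositivityInherited.strictlyPositive_projection (h : PositivityInherited K P₁ P₂) {ψ : H}
    (hψ : StrictlyPositive P₂ ψ) : StrictlyPositive P₁ (K.orthogonalProjectionOnto ψ) := by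
  refine ⟨h.eq_image ▸ ⟨ψ, hψ.1, rfl⟩, fun ξ hξ h0 => ?_⟩
  rw [Submodule.inner_orthogonalProjectionOnto_eq_of_mem_left]
  exact hψ.2 ξ (h.coe_mem hξ) (by simpa using h0)

theorem inner_pos_symm {x y : H} (h : 0 < inner ℂ x y) : 0 < inner ℂ y x := by
  rw [Complex.pos_iff] at h ⊢
  rw [← inner_conj_symm, Complex.conj_re, Complex.conj_im, ← h.2, neg_zero]
  exact ⟨h.1, rfl⟩

theorem rho_smul (ψ : H) {c : ℂ} (hc : ‖c‖ = 1) : rho (c • ψ) = rho ψ := by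
  ext x
  simp only [rho, InnerProductSpace.rankOne_apply, inner_smul_left, smul_smul]
  rw [mul_right_comm, Complex.conj_mul', hc]
  simp

theorem condExpectation_rho (ψ : H) :
    condExpectation K (rho ψ) = rho (K.starProjection ψ) + rho (Kᗮ.starProjection ψ) := by
  ext x
  simp only [condExpectation, rho, add_apply, ContinuousLinearMap.comp_apply,
    InnerProductSpace.rankOne_apply, map_smul, Submodule.inner_starProjection_left_eq_right]

theorem condExpectation_rho_apply_coe (ψ : H) (ξ : K) :
    condExpectation K (rho ψ) (ξ : H) = (inner ℂ ψ (ξ : H) : ℂ) • K.starProjection ψ := by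
  simp [condExpectation, rho]

theorem compression_condExpectation_rho_apply (ψ : H) (ξ : K) :
    compression K (condExpectation K (rho ψ)) ξ =
      (inner ℂ ψ (ξ : H) : ℂ) • K.orthogonalProjectionOnto ψ := by
  simp only [compression, ContinuousLinearMap.comp_apply, Submodule.subtypeL_apply,
    condExpectation_rho_apply_coe, map_smul]
  rw [Submodule.starProjection_apply, Submodule.orthogonalProjectionOnto_mem_subspace_eq_self]

end Inheritance

/-! ### Hilbert–Schmidt operators -/

section HilbertSchmidt

variable {H : Type*} [NormedAddCommGroup H] [InnerProductSpace ℂ H] {ι : Type*}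

theorem isHilbertSchmidt_rho (b : HilbertBasis ι ℂ H) (ψ : H) : IsHilbertSchmidt b (rho ψ) := by
  have := (b.orthonormal.inner_products_summable ψ).mul_right (‖ψ‖ ^ 2)
  refine this.congr fun i => ?_
  rw [rho, InnerProductSpace.rankOne_apply, norm_smul, mul_pow, norm_inner_symm]

theorem IsHilbertSchmidt.add {b : HilbertBasis ι ℂ H} {A B : H →L[ℂ] H} (hA : IsHilbertSchmidt b A)
    (hB : IsHilbertSchmidt b B) : IsHilbertSchmidt b (A + B) := by
  refine Summable.of_nonneg_of_le (fun _ => by positivity) (fun i => ?_)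
    ((Summable.add hA hB).mul_left 2)
  rw [add_apply]
  calc ‖A (b i) + B (b i)‖ ^ 2 ≤ (‖A (b i)‖ + ‖B (b i)‖) ^ 2 := by gcongr; exact norm_add_le _ _
    _ ≤ 2 * (‖A (b i)‖ ^ 2 + ‖B (b i)‖ ^ 2) := add_sq_le

/-- Parseval's identity for `B* ψ` and `ψ`; the value does not depend on the basis. -/
theorem hsInner_rho_left [CompleteSpace H] (b : HilbertBasis ι ℂ H) (ψ : H) (B : H →L[ℂ] H) :
    hsInner b (rho ψ) B = inner ℂ ψ (B ψ) := by
  have h := b.tsum_inner_mul_inner (ContinuousLinearMap.adjoint B ψ) ψ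
  rw [ContinuousLinearMap.adjoint_inner_left] at h
  rw [← h, hsInner]
  refine tsum_congr fun i => ?_
  rw [ContinuousLinearMap.comp_apply, ContinuousLinearMap.adjoint_inner_right,
    ContinuousLinearMap.adjoint_inner_left, rho, InnerProductSpace.rankOne_apply,
    inner_smul_left, inner_conj_symm, mul_comm]

end HilbertSchmidt

end StrictPositivity
-- The main theorem
theorem theorem2p8 {H : Type*} [NormedAddCommGroup H] [InnerProductSpace ℂ H] [CompleteSpace H]
    (K : Submodule ℂ H) [CompleteSpace K] [Nontrivial K]
    (P₁ : Set K) (P₂ : Set H)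
    (hP₁ : StrictPositivity.IsSelfDualCone P₁) (hP₂ : StrictPositivity.IsSelfDualCone P₂)
    (A₁ : K →ₗ.[ℂ] K) (A₂ : H →ₗ.[ℂ] H)
    (h : StrictPositivity.StrictPositivityInherited K A₁ P₁ A₂ P₂)
    {ι : Type*} (b : HilbertBasis ι ℂ H) :
    -- the ground states exist, are unique up to a phase, and can be chosen strictly positive
    (∃ ψ₁ : K, StrictPositivity.IsGroundState A₁ ψ₁ ∧ StrictPositivity.StrictlyPositive P₁ ψ₁ ∧
      ∀ φ : K, StrictPositivity.IsGroundState A₁ φ → ∃ c : ℂ, ‖c‖ = 1 ∧ φ = c • ψ₁) ∧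
    (∃ ψ₂ : H, StrictPositivity.IsGroundState A₂ ψ₂ ∧ StrictPositivity.StrictlyPositive P₂ ψ₂ ∧
      ∀ φ : H, StrictPositivity.IsGroundState A₂ φ → ∃ c : ℂ, ‖c‖ = 1 ∧ φ = c • ψ₂) ∧
    ∀ (ψ₁ : K) (ψ₂ : H),
      StrictPositivity.IsGroundState A₁ ψ₁ → StrictPositivity.IsGroundState A₂ ψ₂ →
      -- the overlap, for the ground states whose phase is fixed by positivity
      (ψ₁ ∈ P₁ → ψ₂ ∈ P₂ → 0 < inner ℂ ψ₁ (K.orthogonalProjectionOnto ψ₂)) ∧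
      -- the overlap of the density matrices
      (StrictPositivity.IsHilbertSchmidt b (StrictPositivity.rho (ψ₁ : H)) ∧
        StrictPositivity.IsHilbertSchmidt b
          (StrictPositivity.condExpectation K (StrictPositivity.rho ψ₂)) ∧
        0 < StrictPositivity.hsInner b (StrictPositivity.rho (ψ₁ : H))
          (StrictPositivity.condExpectation K (StrictPositivity.rho ψ₂))) ∧
      -- positivity improvement of the compressed density matrix
      StrictPositivity.ImprovesPositivity P₁
        (StrictPositivity.compression K
          (StrictPositivity.condExpectation K (StrictPositivity.rho ψ₂))) := by
  have : Nontrivial H := K.subtype_injective.nontrivial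
  obtain ⟨φ₁, hφ₁, hφ₁P, huniq₁, hpos₁⟩ := h.mem₁.exists_groundState hP₁
  obtain ⟨φ₂, hφ₂, hφ₂P, huniq₂, hpos₂⟩ := h.mem₂.exists_groundState hP₂
  have hne : ∀ {ψ : K}, StrictPositivity.IsGroundState A₁ ψ → ψ ≠ 0 := fun hψ =>
    norm_ne_zero_iff.1 (by rw [hψ.1]; exact one_ne_zero)
  have hproj := h.inherited.strictlyPositive_projection hφ₂P
  refine ⟨⟨φ₁, hφ₁, hφ₁P, huniq₁⟩, ⟨φ₂, hφ₂, hφ₂P, huniq₂⟩, fun ψ₁ ψ₂ hψ₁ hψ₂ => ⟨?_, ?_, ?_⟩⟩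
  · intro h₁ h₂
    exact (h.inherited.strictlyPositive_projection (hpos₂ ψ₂ hψ₂ h₂)).2 ψ₁ h₁ (hne hψ₁)
  · refine ⟨StrictPositivity.isHilbertSchmidt_rho b _, ?_, ?_⟩
    · rw [StrictPositivity.condExpectation_rho]
      exact (StrictPositivity.isHilbertSchmidt_rho b _).add
        (StrictPositivity.isHilbertSchmidt_rho b _)
    -- Density matrices do not see phases, so the positive representatives suffice; the trace is
    -- `⟨φ₂, φ₁⟩ ⟨φ₁, π φ₂⟩`.
    · obtain ⟨c₁, hc₁, rfl⟩ := huniq₁ ψ₁ hψ₁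
      obtain ⟨c₂, hc₂, rfl⟩ := huniq₂ ψ₂ hψ₂
      rw [Submodule.coe_smul, StrictPositivity.rho_smul _ hc₁, StrictPositivity.rho_smul _ hc₂,
        StrictPositivity.hsInner_rho_left, StrictPositivity.condExpectation_rho_apply_coe,
        inner_smul_right]
      have hov := hproj.2 φ₁ hφ₁P.1 (hne hφ₁)
      refine mul_pos ?_ hov
      rw [← Submodule.inner_orthogonalProjectionOnto_eq_of_mem_right]
      exact StrictPositivity.inner_pos_symm hov
  · intro ξ hξ h0
    obtain ⟨c, hc, rfl⟩ := huniq₂ ψ₂ hψ₂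
    have hov : 0 < inner ℂ φ₂ (ξ : H) :=
      StrictPositivity.inner_pos_symm (hφ₂P.2 ξ (h.inherited.coe_mem hξ) (by simpa using h0))
    rw [StrictPositivity.rho_smul _ hc, StrictPositivity.compression_condExpectation_rho_apply]
    obtain ⟨hre, him⟩ := Complex.pos_iff.1 hov
    rw [show (inner ℂ φ₂ (ξ : H) : ℂ) = ((inner ℂ φ₂ (ξ : H) : ℂ).re : ℂ) from
      Complex.ext rfl him.symm]
    exact hproj.smul hP₁ hre
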